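/- **Setting.** Terms are pure (finite) $\lambda$-terms up to $\alpha$-conversion, and $\to_\beta^*$ is the reflexive-transitive closure of $\beta$-reduction in arbitrary contexts. The *order* of a term $t$ is $$\mathrm{ord}(t)=\sup\{\,n\in\mathbb N \mid t\to_\beta^*\lambda x_1\ldots\lambda x_n.u \text{ for some } x_1,\dots,x_n,u\,\}\in\mathbb N\cup\{\infty\}.$$ Let $\mathscr O$ be a non-empty set of type atoms. The types of system $\mathscr R$ are defined coinductively (so they may be infinite) by $$\sigma,\tau ::= o\in\mathscr O \mid [\sigma_i]_{i\in I}\to\tau,$$ where $[\sigma_i]_{i\in I}$ is a multiset of types with $I$ countable (empty, finite or infinite). The *order* of a type is its number of top-level arrows: $\mathrm{ord}(\tau)=\sup\{\,n \mid \tau=\mathcal I_1\to\cdots\to\mathcal I_n\to\tau' \text{ for some multisets } \mathcal I_1,\dots,\mathcal I_n \text{ and some type } \tau'\,\}\in\mathbb N\cup\{\infty\}$. A context is a total function from variables to countable multisets of types; sums of contexts are taken pointwise, and $x:[\tau]$ denotes the context with value $[\tau]$ at $x$ and $[\,]$ elsewhere. Derivations of system $\mathscr R$ are defined inductively by the rules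 * (ax) $x:[\tau]\vdash x:\tau$; * (abs) from $\Gamma;\,x:[\sigma_i]_{i\in I}\vdash t:\tau$, with $\Gamma(x)=[\,]$, infer $\Gamma\vdash\lambda x.t:[\sigma_i]_{i\in I}\to\tau$; * (app) from $\Gamma\vdash t:[\sigma_i]_{i\in I}\to\tau$ and $\Delta_i\vdash u:\sigma_i$ for every $i\in I$, infer $\Gamma+\sum_{i\in I}\Delta_i\vdash t\,u:\tau$. The interpretation of $t$ in the infinitary relational model is $[\![t]\!]=\{(\Gamma,\tau)\mid \Gamma\vdash t:\tau \text{ is derivable}\}$. **Theorem.** Let $t$ be a $\lambda$-term of order $n\in\mathbb N\cup\{\infty\}$. Then there are a context $\Gamma$ and a type $\tau$ of order exactly $n$ such that $\Gamma\vdash t:\tau$ is derivable in system $\mathscr R$; moreover, every type $\tau$ such that $\Gamma\vdash t:\tau$ is derivable for some context $\Gamma$ has order at least $n$. Consequently the infinitary relational model is order-discriminating for all terms: if $t$ and $u$ are $\lambda$-terms with different orders, then $[\![t]\!]\neq[\![u]\!]$. -/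

import Mathlib

/-! ## Pure lambda-terms, beta-reduction and the order of a term -/

/-- Pure `λ`-terms modulo renaming of bound variables (de Bruijn indices).
Variables are natural numbers, the index `0` under `lam` being the variable it binds. -/
inductive Term : Type
  | var : ℕ → Term
  | lam : Term → Term
  | app : Term → Term → Term

namespace Term

/-- The renaming `r`, pushed under one binder. -/
def liftRen (r : ℕ → ℕ) : ℕ → ℕ
  | 0 => 0
  | n + 1 => r n + 1

/-- Renaming of the free variables. -/
def rename : (ℕ → ℕ) → Term → Term
  | r, var n => var (r n)
  | r, lam t => lam (rename (liftRen r) t)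
  | r, app t u => app (rename r t) (rename r u)

/-- The substitution `s`, pushed under one binder. -/
def liftSubst (s : ℕ → Term) : ℕ → Term
  | 0 => var 0
  | n + 1 => rename Nat.succ (s n)

/-- Parallel capture-avoiding substitution. -/
def subst : (ℕ → Term) → Term → Term
  | s, var n => s n
  | s, lam t => lam (subst (liftSubst s) t)
  | s, app t u => app (subst s t) (subst s u)

/-- The substitution that sends the variable `0` to `u` and lowers all the others by one. -/
def instSubst (u : Term) : ℕ → Term
  | 0 => u
  | n + 1 => var n

/-- One step of `β`-reduction, in an arbitrary context. -/
inductive Step : Term → Term → Prop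
  | beta (t u : Term) : Step (app (lam t) u) (subst (instSubst u) t)
  | lam {t t' : Term} : Step t t' → Step (lam t) (lam t')
  | appLeft {t t' : Term} (u : Term) : Step t t' → Step (app t u) (app t' u)
  | appRight (t : Term) {u u' : Term} : Step u u' → Step (app t u) (app t u')

/-- `t →β* u`. -/
def Reduces : Term → Term → Prop := Relation.ReflTransGen Step

/-- `lams n u` is `λx₁ … λxₙ. u`. -/
def lams : ℕ → Term → Term
  | 0, u => u
  | n + 1, u => lam (lams n u)

/-- The order of a term: the supremum in `ℕ ∪ {∞}` of the `n` such that
`t →β* λx₁ … λxₙ. u` for some `u`. -/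
noncomputable def order (t : Term) : ℕ∞ :=
  sSup {m : ℕ∞ | ∃ n : ℕ, m = n ∧ ∃ u, Reduces t (lams n u)}

end Term

/-! ## Countable multisets -/

/-- Two families of elements of `X`, indexed by sets of natural numbers, are the same multiset
when a bijection of the index sets carries one to the other. -/
def familySetoid (X : Type) : Setoid (Σ K : Set ℕ, K → X) where
  r F G := ∃ e : F.1 ≃ G.1, ∀ k, F.2 k = G.2 (e k)
  iseqv :=
    { refl := fun _ => ⟨Equiv.refl _, fun _ => rfl⟩
      symm := by
        rintro F G ⟨e, h⟩
        exact ⟨e.symm, fun k => by rw [h, Equiv.apply_symm_apply]⟩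
      trans := by
        rintro F G H ⟨e, h⟩ ⟨e', h'⟩
        exact ⟨e.trans e', fun k => by rw [h, h', Equiv.trans_apply]⟩ }

/-- Multisets `[x_i]_{i ∈ I}` of elements of `X` with `I` countable (finite or infinite). -/
def CMultiset (X : Type) : Type := Quotient (familySetoid X)

namespace CMultiset

variable {X Y : Type}

/-- Functorial action: `[x_i]_{i ∈ I}` is sent to `[f x_i]_{i ∈ I}`. -/
def map (f : X → Y) : CMultiset X → CMultiset Y :=
  Quotient.map' (s₁ := familySetoid X) (s₂ := familySetoid Y)
    (fun F => ⟨F.1, fun k => f (F.2 k)⟩)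
    (by rintro F G ⟨e, h⟩; exact ⟨e, fun k => congrArg f (h k)⟩)

/-- The multiset `[f i]_{i ∈ ι}` of a family indexed by an arbitrary countable type. -/
noncomputable def ofFamily {ι : Type} [hι : Countable ι] (f : ι → X) : CMultiset X :=
  Quotient.mk (familySetoid X)
    ⟨Set.range hι.exists_injective_nat.choose,
      fun k => f ((Equiv.ofInjective _ hι.exists_injective_nat.choose_spec).symm k)⟩

/-- The empty multiset `[ ]`. -/
noncomputable def empty : CMultiset X := ofFamily (fun i : Empty => i.elim)

/-- The multiset `[x]`. -/
noncomputable def single (x : X) : CMultiset X := ofFamily (fun _ : Unit => x)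

/-- The sum of a countable family of countable multisets. It does not depend on the
representatives chosen for the summands: see `sum_ofFamily`. -/
noncomputable def sum {ι : Type} [Countable ι] (M : ι → CMultiset X) : CMultiset X :=
  ofFamily (fun p : (Σ i, ((M i).out.1 : Set ℕ)) => (M p.1).out.2 p.2)

/-- Binary sum of multisets. -/
noncomputable instance : Add (CMultiset X) :=
  ⟨fun M N => sum (fun b : Bool => cond b M N)⟩

theorem ofFamily_eq_iff {ι κ : Type} [Countable ι] [Countable κ] (f : ι → X) (g : κ → X) :
    ofFamily f = ofFamily g ↔ ∃ e : ι ≃ κ, ∀ i, f i = g (e i) := by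
  refine Iff.trans (Quotient.eq (r := familySetoid X)) ?_
  constructor
  · rintro ⟨e, h⟩
    refine ⟨((Equiv.ofInjective _ (Countable.exists_injective_nat (α := ι)).choose_spec).trans
      e).trans (Equiv.ofInjective _ (Countable.exists_injective_nat (α := κ)).choose_spec).symm,
      fun i => ?_⟩
    have := h (Equiv.ofInjective _ (Countable.exists_injective_nat (α := ι)).choose_spec i)
    simpa using this
  · rintro ⟨e, h⟩
    refine ⟨((Equiv.ofInjective _ (Countable.exists_injective_nat (α := ι)).choose_spec).symm.trans
      e).trans (Equiv.ofInjective _ (Countable.exists_injective_nat (α := κ)).choose_spec),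
      fun k => ?_⟩
    simp [h]

theorem mk_eq_ofFamily (F : Σ K : Set ℕ, K → X) :
    (Quotient.mk (familySetoid X) F : CMultiset X) = ofFamily F.2 := by
  apply Quotient.sound
  refine ⟨Equiv.ofInjective _ (Countable.exists_injective_nat (α := F.1)).choose_spec, fun k => ?_⟩
  simp

theorem ofFamily_out (M : CMultiset X) : ofFamily (Quotient.out M).2 = M := by
  rw [← mk_eq_ofFamily]
  exact Quotient.out_eq M

theorem map_ofFamily {ι : Type} [Countable ι] (g : X → Y) (f : ι → X) :
    map g (ofFamily f) = ofFamily (fun i => g (f i)) := rfl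

theorem sum_ofFamily {ι : Type} [Countable ι] {κ : ι → Type} [∀ i, Countable (κ i)]
    (f : ∀ i, κ i → X) :
    sum (fun i => ofFamily (f i)) = ofFamily (fun p : Σ i, κ i => f p.1 p.2) := by
  unfold sum
  rw [ofFamily_eq_iff]
  have h := fun i => (ofFamily_eq_iff _ _).1 (ofFamily_out (ofFamily (f i)))
  choose e he using h
  exact ⟨Equiv.sigmaCongrRight e, fun p => he p.1 p.2⟩

theorem add_ofFamily {ι κ : Type} [Countable ι] [Countable κ] (f : ι → X) (g : κ → X) :
    ofFamily f + ofFamily g = ofFamily (Sum.elim f g) := by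
  change sum (fun b : Bool => cond b (ofFamily f) (ofFamily g)) = _
  unfold sum
  rw [ofFamily_eq_iff]
  obtain ⟨e, he⟩ := (ofFamily_eq_iff _ _).1 (ofFamily_out (ofFamily f))
  obtain ⟨e', he'⟩ := (ofFamily_eq_iff _ _).1 (ofFamily_out (ofFamily g))
  refine ⟨⟨fun p => match p with
      | ⟨true, k⟩ => Sum.inl (e k)
      | ⟨false, k⟩ => Sum.inr (e' k),
    fun q => match q with
      | Sum.inl i => ⟨true, e.symm i⟩
      | Sum.inr j => ⟨false, e'.symm j⟩, ?_, ?_⟩, ?_⟩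
  · rintro ⟨_ | _, k⟩ <;> simp
  · rintro (i | j) <;> simp
  · rintro ⟨_ | _, k⟩
    · exact he' k
    · exact he k

end CMultiset

/-! ## The types: the coinductive grammar `σ, τ ::= o | [σ_i]_{i ∈ I} → τ` -/

/-- One layer of the grammar, over a set `O` of type atoms. -/
inductive RTypeF (O X : Type) : Type
  | atom : O → RTypeF O X
  | arrow : CMultiset X → X → RTypeF O X

namespace RTypeF

variable {O : Type}

/-- Functorial action of a layer of the grammar. -/
def map {X Y : Type} (f : X → Y) : RTypeF O X → RTypeF O Y
  | atom o => atom o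
  | arrow M x => arrow (M.map f) (f x)

/-- Positions of the immediate subtypes: none in an atom; in an arrow, the target (`none`) and
the elements of the source. -/
def Pos : O ⊕ Set ℕ → Type
  | Sum.inl _ => Empty
  | Sum.inr K => Option K

/-- The layer functor is a quotient of a polynomial functor, so that its final coalgebra is
available as `QPF.Cofix`. -/
noncomputable instance : QPF (RTypeF O) where
  map := map
  P := ⟨O ⊕ Set ℕ, Pos⟩
  abs := fun p => match p with
    | ⟨Sum.inl o, _⟩ => atom o
    | ⟨Sum.inr K, f⟩ =>
        arrow (Quotient.mk (familySetoid _) ⟨K, fun k => f (some k : Option K)⟩)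
          (f (none : Option K))
  repr := fun l => match l with
    | atom o => ⟨Sum.inl o, fun e : Empty => e.elim⟩
    | arrow M x => ⟨Sum.inr M.out.1, fun k : Option M.out.1 => k.elim x M.out.2⟩
  abs_repr := by
    rintro α (o | ⟨M, x⟩)
    · rfl
    · exact congrArg (fun N => arrow N x) (Quotient.out_eq M)
  abs_map := by
    rintro α β f ⟨o | K, g⟩ <;> rfl

end RTypeF

/-- The types: the elements of the final coalgebra, that is, possibly infinite types, with
equality up to permutation of the elements of the multisets, at every depth. -/
def RType (O : Type) : Type := QPF.Cofix (RTypeF O)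

namespace RType

variable {O : Type}

/-- The outermost layer of a type. -/
noncomputable def dest : RType O → RTypeF O (RType O) := QPF.Cofix.dest

/-- The type with a given outermost layer (the inverse of `dest`). -/
noncomputable def mk : RTypeF O (RType O) → RType O :=
  QPF.Cofix.corec (F := RTypeF O) (fun l => RTypeF.map dest l)

theorem mk_dest (τ : RType O) : mk (dest τ) = τ := by
  refine QPF.Cofix.bisim_rel (F := RTypeF O) (fun x y => x = mk (dest y)) ?_ _ _ rfl
  rintro x y rfl
  have h : QPF.Cofix.dest (F := RTypeF O) (mk (dest y)) = mk <$> (dest <$> dest y) :=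
    QPF.Cofix.dest_corec (F := RTypeF O) _ _
  rw [h]
  change (Quot.mk _ <$> mk <$> dest <$> dest y : RTypeF O _) = Quot.mk _ <$> dest y
  rw [← QPF.comp_map, ← QPF.comp_map]
  congr 1
  funext x
  exact Quot.sound rfl

theorem dest_mk (l : RTypeF O (RType O)) : dest (mk l) = l := by
  have h : dest (mk l) = (mk <$> (dest <$> l) : RTypeF O _) :=
    QPF.Cofix.dest_corec (F := RTypeF O) _ _
  rw [h, ← QPF.comp_map, show (mk ∘ dest : RType O → RType O) = id from funext mk_dest,
    QPF.id_map]

/-- The type atom `o`. -/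
noncomputable def atom (o : O) : RType O := mk (RTypeF.atom o)

/-- The arrow type `M → τ`. -/
noncomputable def arrow (M : CMultiset (RType O)) (τ : RType O) : RType O := mk (RTypeF.arrow M τ)

/-- `HasArrows n τ`: the type `τ` is of the form `M₁ → … → Mₙ → τ'`. -/
def HasArrows : ℕ → RType O → Prop
  | 0, _ => True
  | n + 1, τ => ∃ M τ', τ = arrow M τ' ∧ HasArrows n τ'

/-- The order of a type: its number of top-level arrows, in `ℕ ∪ {∞}`. -/
noncomputable def order (τ : RType O) : ℕ∞ :=
  sSup {m : ℕ∞ | ∃ n : ℕ, m = n ∧ HasArrows n τ}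

end RType

/-! ## The type system -/

/-- Contexts: total functions from variables to multiset types. -/
abbrev RContext (O : Type) : Type := ℕ → CMultiset (RType O)

namespace RContext

variable {O : Type}

/-- The context `x : [τ]`, empty on the other variables. -/
noncomputable def single (x : ℕ) (τ : RType O) : RContext O :=
  fun y => if y = x then CMultiset.single τ else CMultiset.empty

end RContext

/-- `Derivable Γ t τ`: the judgment `Γ ⊢ t : τ` has a derivation in the system `𝓡`.
In `abs`, the bound variable is the index `0`. -/
inductive Derivable {O : Type} : RContext O → Term → RType O → Prop
  | ax (x : ℕ) (τ : RType O) : Derivable (RContext.single x τ) (Term.var x) τ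
  | abs {Γ : RContext O} {t : Term} {τ : RType O} :
      Derivable Γ t τ →
      Derivable (fun x => Γ (x + 1)) (Term.lam t) (RType.arrow (Γ 0) τ)
  | app {ι : Type} [Countable ι] {Γ : RContext O} {Δ : ι → RContext O} {t u : Term}
      {σ : ι → RType O} {τ : RType O} :
      Derivable Γ t (RType.arrow (CMultiset.ofFamily σ) τ) →
      (∀ i, Derivable (Δ i) u (σ i)) →
      Derivable (fun x => Γ x + CMultiset.sum (fun i => Δ i x)) (Term.app t u) τ

/-- The interpretation of a term in the infinitary relational model over the atoms `O`:
the set of the pairs `(Γ, τ)` such that `Γ ⊢ t : τ` is derivable. -/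
def denotation (O : Type) (t : Term) : Set (RContext O × RType O) :=
  {p | Derivable p.1 t p.2}

/-! The lower bound is subject reduction (`Derivable.reduces`): a type of a term is also a type of
every reduct `λx₁…λxₘ.u`, and abstractions only have arrow types.

To attain the bound, supply the term with `n` formal arguments and run a Krivine machine on it,
possibly forever. Types are read off the run: the type of a stack is an arrow whose source collects
the types of the stacks present whenever the first argument is called, and whose target is the type
of the remaining stack. This corecursion is possible because types may be infinite and multisets
countable. The initial stack then has a type with exactly `n` arrows (`Machine.order_stackType`).

The derivation (`Machine.derivable_run`) is built by recursion on the code, not along the run, so it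
is well founded even when the run is infinite. The assumptions on a variable are indexed by the
times at which it is used. At an abstraction, the uses of the bound variable are exactly the calls
of the popped closure (`uses_eq_calls`), since a closure is popped at most once. At an application,
the uses in the function and in the copies of the argument are disjoint (`ofFamily_uses_app`), since
the times of the run form a tree. Taking for `n` the order of the term ensures that an abstraction
never lacks an argument (`total_order`).

The order of a term is thus the least order of a type in its interpretation, so the interpretation
determines it. -/

namespace RType

variable {O : Type}

theorem arrow_inj {M N : CMultiset (RType O)} {σ τ : RType O} (h : arrow M σ = arrow N τ) :
    M = N ∧ σ = τ := by
  have h' := congrArg dest h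
  rw [arrow, arrow, dest_mk, dest_mk] at h'
  injection h' with h₁ h₂
  exact ⟨h₁, h₂⟩

theorem atom_ne_arrow (o : O) (M : CMultiset (RType O)) (τ : RType O) : atom o ≠ arrow M τ := by
  intro h
  have h' := congrArg dest h
  rw [arrow, atom, dest_mk, dest_mk] at h'
  cases h'

end RType

/-! ### Contexts as countable families of individual assumptions. -/

namespace RContext

variable {O : Type} {ι κ : Type} [Countable ι] [Countable κ]

/-- The context in which each index `i` contributes one assumption on the variable `(f i).1`,
with type `(f i).2`. -/
noncomputable def ofFamily (f : ι → ℕ × RType O) : RContext O :=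
  fun x => CMultiset.ofFamily (fun i : {i // (f i).1 = x} => (f i).2)

theorem ofFamily_congr {f : ι → ℕ × RType O} {g : κ → ℕ × RType O} (e : ι ≃ κ)
    (h : ∀ i, f i = g (e i)) : ofFamily f = ofFamily g := by
  funext x
  refine (CMultiset.ofFamily_eq_iff _ _).2
    ⟨e.subtypeEquiv (fun i => by rw [h]), fun i => ?_⟩
  simp [h]

/-- The bijections given separately for each variable glue, since an index set is the disjoint union
of its fibres over the variables. Assumptions can thus be traced one by one through a derivation. -/
theorem exists_equiv_of_ofFamily_eq {f : ι → ℕ × RType O} {g : κ → ℕ × RType O}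
    (h : ofFamily f = ofFamily g) : ∃ e : ι ≃ κ, ∀ i, f i = g (e i) := by
  have h' := fun x => (CMultiset.ofFamily_eq_iff _ _).1 (congrFun h x)
  choose e he using h'
  refine ⟨((Equiv.sigmaFiberEquiv fun i => (f i).1).symm.trans (Equiv.sigmaCongrRight e)).trans
    (Equiv.sigmaFiberEquiv fun i => (g i).1), fun i => ?_⟩
  refine Prod.ext ?_ ?_
  · exact (e (f i).1 ⟨i, rfl⟩).2.symm
  · exact he (f i).1 ⟨i, rfl⟩

theorem eq_ofFamily_sigma {K : ℕ → Type} [∀ x, Countable (K x)] (h : ∀ x, K x → RType O) :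
    (fun x => CMultiset.ofFamily (h x)) = ofFamily (fun p : Σ x, K x => (p.1, h p.1 p.2)) := by
  funext x
  refine (CMultiset.ofFamily_eq_iff _ _).2 ⟨⟨fun k => ⟨⟨x, k⟩, rfl⟩,
    fun p => p.2 ▸ p.1.2, fun _ => rfl, ?_⟩, fun _ => rfl⟩
  rintro ⟨⟨y, k⟩, rfl⟩
  rfl

theorem exists_eq_ofFamily (Γ : RContext O) :
    ∃ (ι : Type) (_ : Countable ι) (f : ι → ℕ × RType O), Γ = ofFamily f := by
  refine ⟨_, inferInstance, _, Eq.trans ?_ (eq_ofFamily_sigma fun x => (Γ x).out.2)⟩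
  funext x
  exact (CMultiset.ofFamily_out (Γ x)).symm

theorem single_eq_ofFamily (x : ℕ) (τ : RType O) :
    single x τ = ofFamily (fun _ : Unit => (x, τ)) := by
  funext y
  unfold single
  split_ifs with h
  · subst h
    exact (CMultiset.ofFamily_eq_iff _ _).2
      ⟨⟨fun _ => ⟨(), rfl⟩, fun _ => (), fun _ => rfl, fun _ => rfl⟩, fun _ => rfl⟩
  · have : IsEmpty {_i : Unit // x = y} := ⟨fun i => h i.2.symm⟩
    exact (CMultiset.ofFamily_eq_iff _ _).2 ⟨Equiv.equivOfIsEmpty _ _, fun i => i.elim⟩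

theorem ofFamily_add_sum {κ : ι → Type} [∀ i, Countable (κ i)] {α : Type} [Countable α]
    (f : α → ℕ × RType O) (g : ∀ i, κ i → ℕ × RType O) :
    (fun x => ofFamily f x + CMultiset.sum (fun i => ofFamily (g i) x)) =
      ofFamily (Sum.elim f (fun p : Σ i, κ i => g p.1 p.2)) := by
  funext x
  unfold ofFamily
  rw [CMultiset.sum_ofFamily, CMultiset.add_ofFamily]
  refine (CMultiset.ofFamily_eq_iff _ _).2 ⟨⟨fun q => match q with
      | Sum.inl a => ⟨Sum.inl a.1, a.2⟩
      | Sum.inr p => ⟨Sum.inr ⟨p.1, p.2.1⟩, p.2.2⟩,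
    fun q => match q with
      | ⟨Sum.inl a, h⟩ => Sum.inl ⟨a, h⟩
      | ⟨Sum.inr p, h⟩ => Sum.inr ⟨p.1, ⟨p.2, h⟩⟩, ?_, ?_⟩, ?_⟩
  · rintro (a | p) <;> rfl
  · rintro ⟨a | p, h⟩ <;> rfl
  · rintro (a | p) <;> rfl

/-- The family of a context under one more binder: `f` shifted by one, and the types `h` for the
variable `0`. -/
def consFamily (h : κ → RType O) (f : ι → ℕ × RType O) : ι ⊕ κ → ℕ × RType O :=
  Sum.elim (fun i => ((f i).1 + 1, (f i).2)) (fun k => (0, h k))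

theorem ofFamily_consFamily_zero (h : κ → RType O) (f : ι → ℕ × RType O) :
    ofFamily (consFamily h f) 0 = CMultiset.ofFamily h := by
  refine (CMultiset.ofFamily_eq_iff _ _).2 ⟨⟨fun q => match q with
      | ⟨Sum.inl a, h⟩ => absurd h (Nat.succ_ne_zero _)
      | ⟨Sum.inr k, _⟩ => k,
    fun k => ⟨Sum.inr k, rfl⟩, ?_, fun _ => rfl⟩, ?_⟩
  · rintro ⟨a | k, h⟩
    · exact absurd h (Nat.succ_ne_zero _)
    · rfl
  · rintro ⟨a | k, h⟩
    · exact absurd h (Nat.succ_ne_zero _)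
    · rfl

theorem ofFamily_consFamily_succ (h : κ → RType O) (f : ι → ℕ × RType O) :
    (fun x => ofFamily (consFamily h f) (x + 1)) = ofFamily f := by
  funext x
  refine (CMultiset.ofFamily_eq_iff _ _).2 ⟨⟨fun q => match q with
      | ⟨Sum.inl a, h⟩ => ⟨a, Nat.succ_injective h⟩
      | ⟨Sum.inr k, h⟩ => absurd h.symm (Nat.succ_ne_zero _),
    fun k => ⟨Sum.inl k.1, congrArg Nat.succ k.2⟩, ?_, fun _ => rfl⟩, ?_⟩
  · rintro ⟨a | k, h⟩
    · rfl
    · exact absurd h.symm (Nat.succ_ne_zero _)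
  · rintro ⟨a | k, h⟩
    · rfl
    · exact absurd h.symm (Nat.succ_ne_zero _)

theorem eq_ofFamily_consFamily {Γ : RContext O} {h : κ → RType O} {f : ι → ℕ × RType O}
    (h0 : Γ 0 = CMultiset.ofFamily h) (hs : (fun x => Γ (x + 1)) = ofFamily f) :
    Γ = ofFamily (consFamily h f) := by
  funext x
  cases x with
  | zero => rw [h0, ofFamily_consFamily_zero]
  | succ x => rw [congrFun (ofFamily_consFamily_succ h f) x]; exact congrFun hs x

end RContext

/-! ### Subject reduction and the lower bound. -/

namespace Derivable

variable {O : Type}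

open RContext

theorem of_eq {Γ Γ' : RContext O} {t : Term} {τ : RType O} (h : Derivable Γ t τ) (e : Γ = Γ') :
    Derivable Γ' t τ := e ▸ h

theorem abs_consFamily {ι κ : Type} [Countable ι] [Countable κ] {h : κ → RType O}
    {f : ι → ℕ × RType O} {t : Term} {τ : RType O}
    (d : Derivable (ofFamily (consFamily h f)) t τ) :
    Derivable (ofFamily f) (Term.lam t) (RType.arrow (CMultiset.ofFamily h) τ) := by
  have d' := d.abs
  rwa [ofFamily_consFamily_zero, ofFamily_consFamily_succ] at d'

theorem rename {Γ : RContext O} {t : Term} {τ : RType O} (d : Derivable Γ t τ) :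
    ∀ (r : ℕ → ℕ) {ι : Type} [Countable ι] (f : ι → ℕ × RType O), Γ = ofFamily f →
      Derivable (ofFamily fun i => (r (f i).1, (f i).2)) (t.rename r) τ := by
  induction d with
  | ax x τ =>
    intro r ι _ f hf
    rw [single_eq_ofFamily] at hf
    obtain ⟨e, he⟩ := exists_equiv_of_ofFamily_eq hf
    refine (Derivable.ax (r x) τ).of_eq ?_
    rw [single_eq_ofFamily]
    exact ofFamily_congr e fun i => by rw [← he]
  | @abs Γ t τ _ ih =>
    intro r ι _ f hf
    have h0 := (CMultiset.ofFamily_out (Γ 0)).symm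
    have := ih (Term.liftRen r) _ (eq_ofFamily_consFamily h0 hf)
    rw [h0]
    refine abs_consFamily (this.of_eq (ofFamily_congr (Equiv.refl _) ?_))
    rintro (i | k) <;> rfl
  | @app κ _ Γ Δ t u σ τ _ _ iht ihu =>
    intro r ι _ f hf
    obtain ⟨α, _, g, rfl⟩ := exists_eq_ofFamily Γ
    choose β hβ g' hg' using fun i => exists_eq_ofFamily (Δ i)
    have : (fun x => ofFamily g x + CMultiset.sum fun i => Δ i x) =
        ofFamily (Sum.elim g (fun p : Σ i, β i => g' p.1 p.2)) := by
      rw [← ofFamily_add_sum]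
      simp only [hg']
    rw [this] at hf
    obtain ⟨e, he⟩ := exists_equiv_of_ofFamily_eq hf
    have D := Derivable.app (iht r g rfl) (fun i => ihu i r (g' i) (hg' i))
    rw [ofFamily_add_sum] at D
    refine D.of_eq (ofFamily_congr e ?_)
    rintro (i | k)
    · simp [← he]
    · simp [← he]

/-- The system is linear: each assumption is consumed by one axiom, so each is given its own
derivation and the resources are added up. The labelling `f` of the context is arbitrary so that the
induction can choose it in the premises. -/
theorem subst {Γ : RContext O} {t : Term} {τ : RType O} (d : Derivable Γ t τ) :
    ∀ (s : ℕ → Term) {ι : Type} [Countable ι] (f : ι → ℕ × RType O) {κ : ι → Type}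
      [∀ i, Countable (κ i)] (g : ∀ i, κ i → ℕ × RType O), Γ = ofFamily f →
      (∀ i, Derivable (ofFamily (g i)) (s (f i).1) (f i).2) →
      Derivable (ofFamily fun p : Σ i, κ i => g p.1 p.2) (t.subst s) τ := by
  induction d with
  | ax x τ =>
    intro s ι _ f κ _ g hf hg
    rw [single_eq_ofFamily] at hf
    obtain ⟨e, he⟩ := exists_equiv_of_ofFamily_eq hf
    have h := hg (e ())
    rw [← he] at h
    refine h.of_eq (ofFamily_congr ⟨fun j => ⟨e (), j⟩, fun p =>
      (show p.1 = e () from by rw [← e.apply_symm_apply p.1]) ▸ p.2, fun _ => rfl, ?_⟩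
      fun _ => rfl)
    rintro ⟨i, j⟩
    obtain ⟨⟨⟩, rfl⟩ := e.surjective i
    rfl
  | @abs Γ t τ _ ih =>
    intro s ι _ f κ _ g hf hg
    have h0 := (CMultiset.ofFamily_out (Γ 0)).symm
    generalize (Γ 0).out.2 = h at h0
    -- Each assumption on the bound variable is served by an axiom, which has a single assumption.
    let κ' : ι ⊕ (Γ 0).out.1 → Type := Sum.elim κ fun _ => Unit
    have : ∀ i, Countable (κ' i) := by
      rintro (i | k)
      · exact inferInstanceAs (Countable (κ i))
      · exact inferInstanceAs (Countable Unit)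
    let g' : ∀ i, κ' i → ℕ × RType O := fun i => match i with
      | Sum.inl i => fun j => ((g i j).1 + 1, (g i j).2)
      | Sum.inr k => fun _ => (0, h k)
    have D := ih (Term.liftSubst s) _ g' (eq_ofFamily_consFamily h0 hf) (by
      rintro (i | k)
      · exact (hg i).rename Nat.succ (g i) rfl
      · refine (Derivable.ax 0 (h k)).of_eq ?_
        rw [single_eq_ofFamily]
        rfl)
    rw [h0]
    refine abs_consFamily (D.of_eq (ofFamily_congr ⟨fun p => match p with
      | ⟨Sum.inl i, j⟩ => Sum.inl ⟨i, j⟩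
      | ⟨Sum.inr k, _⟩ => Sum.inr k,
      fun p => match p with
      | Sum.inl p => ⟨Sum.inl p.1, p.2⟩
      | Sum.inr k => ⟨Sum.inr k, ()⟩, ?_, ?_⟩ ?_))
    · rintro ⟨i | k, j⟩ <;> rfl
    · rintro (p | k) <;> rfl
    · rintro ⟨i | k, j⟩ <;> rfl
  | @app μ _ Γ Δ t u σ τ _ _ iht ihu =>
    intro s ι _ f κ _ g hf hg
    obtain ⟨α, _, a, rfl⟩ := exists_eq_ofFamily Γ
    choose β hβ b hb using fun i => exists_eq_ofFamily (Δ i)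
    have : (fun x => ofFamily a x + CMultiset.sum fun i => Δ i x) =
        ofFamily (Sum.elim a (fun p : Σ i, β i => b p.1 p.2)) := by
      rw [← ofFamily_add_sum]
      simp only [hb]
    rw [this] at hf
    obtain ⟨e, he⟩ := exists_equiv_of_ofFamily_eq hf
    have D := Derivable.app
      (iht s a (fun i => g (e (Sum.inl i))) rfl
        (fun i => by have h := hg (e (Sum.inl i)); rw [← he] at h; exact h))
      (fun i => ihu i s (b i) (fun j => g (e (Sum.inr ⟨i, j⟩))) (hb i)
        (fun j => by have h := hg (e (Sum.inr ⟨i, j⟩)); rw [← he] at h; exact h))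
    rw [ofFamily_add_sum] at D
    refine D.of_eq (ofFamily_congr (Equiv.trans ⟨fun q => match q with
      | Sum.inl p => ⟨Sum.inl p.1, p.2⟩
      | Sum.inr p => ⟨Sum.inr ⟨p.1, p.2.1⟩, p.2.2⟩,
      fun q => match q with
      | ⟨Sum.inl i, j⟩ => Sum.inl ⟨i, j⟩
      | ⟨Sum.inr p, j⟩ => Sum.inr ⟨p.1, ⟨p.2, j⟩⟩, ?_, ?_⟩
      (Equiv.sigmaCongrLeft (β := κ) e)) ?_)
    · rintro (p | p) <;> rfl
    · rintro ⟨i | p, j⟩ <;> rfl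
    · rintro (p | p) <;> rfl

theorem lam_inv {Γ : RContext O} {t : Term} {τ : RType O} (d : Derivable Γ (Term.lam t) τ) :
    ∃ (Γ' : RContext O) (τ' : RType O), Γ = (fun x => Γ' (x + 1)) ∧
      τ = RType.arrow (Γ' 0) τ' ∧ Derivable Γ' t τ' := by
  cases d with
  | abs d => exact ⟨_, _, rfl, rfl, d⟩

/-- Injectivity of the arrow matches the assumptions on the bound variable with the derivations of
the argument; the other assumptions are served by axioms. -/
theorem beta {Γ : RContext O} {t u : Term} {τ : RType O}
    (d : Derivable Γ (Term.app (Term.lam t) u) τ) :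
    Derivable Γ (t.subst (Term.instSubst u)) τ := by
  cases d with
  | @app ι _ Γ Δ _ _ σ _ dt du =>
    obtain ⟨Γ', τ', rfl, hτ, dt⟩ := dt.lam_inv
    obtain ⟨h0, rfl⟩ := RType.arrow_inj hτ
    obtain ⟨α, _, a, ha⟩ := exists_eq_ofFamily (fun x => Γ' (x + 1))
    choose β hβ b hb using fun i => exists_eq_ofFamily (Δ i)
    let κ : α ⊕ ι → Type := Sum.elim (fun _ => Unit) β
    have : ∀ i, Countable (κ i) := by
      rintro (i | k)
      · exact inferInstanceAs (Countable Unit)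
      · exact inferInstanceAs (Countable (β k))
    let g : ∀ i, κ i → ℕ × RType O := fun i => match i with
      | Sum.inl i => fun _ => a i
      | Sum.inr k => b k
    have D := dt.subst (Term.instSubst u) _ g (eq_ofFamily_consFamily h0.symm ha) (by
      rintro (i | k)
      · refine (Derivable.ax (a i).1 (a i).2).of_eq ?_
        rw [single_eq_ofFamily]
        rfl
      · exact (du k).of_eq (hb k))
    refine D.of_eq ?_
    have : (fun x => Γ' (x + 1) + CMultiset.sum fun i => Δ i x) =
        ofFamily (Sum.elim a (fun p : Σ i, β i => b p.1 p.2)) := by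
      rw [← ofFamily_add_sum, ← ha]
      simp only [hb]
    rw [this]
    refine ofFamily_congr ⟨fun p => match p with
      | ⟨Sum.inl i, _⟩ => Sum.inl i
      | ⟨Sum.inr k, j⟩ => Sum.inr ⟨k, j⟩,
      fun p => match p with
      | Sum.inl i => ⟨Sum.inl i, ()⟩
      | Sum.inr p => ⟨Sum.inr p.1, p.2⟩, ?_, ?_⟩ ?_
    · rintro ⟨i | k, j⟩ <;> rfl
    · rintro (p | k) <;> rfl
    · rintro ⟨i | k, j⟩ <;> rfl

theorem step {t t' : Term} (h : Term.Step t t') :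
    ∀ {Γ : RContext O} {τ : RType O}, Derivable Γ t τ → Derivable Γ t' τ := by
  induction h with
  | beta t u => exact fun d => d.beta
  | lam _ ih =>
    intro Γ τ d
    cases d with
    | abs d => exact (ih d).abs
  | appLeft u _ ih =>
    intro Γ τ d
    cases d with
    | app dt du => exact (ih dt).app du
  | appRight t _ ih =>
    intro Γ τ d
    cases d with
    | app dt du => exact dt.app fun i => ih (du i)

theorem reduces {t t' : Term} (h : Term.Reduces t t') {Γ : RContext O} {τ : RType O}
    (d : Derivable Γ t τ) : Derivable Γ t' τ := by
  induction h with
  | refl => exact d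
  | tail _ hs ih => exact ih.step hs

theorem hasArrows_of_lams {u : Term} :
    ∀ (n : ℕ) {Γ : RContext O} {τ : RType O}, Derivable Γ (Term.lams n u) τ →
      RType.HasArrows n τ
  | 0, _, _, _ => trivial
  | n + 1, _, _, d => by
    obtain ⟨Γ', τ', _, hτ, d'⟩ := d.lam_inv
    exact ⟨_, τ', hτ, hasArrows_of_lams n d'⟩

theorem order_le {Γ : RContext O} {t : Term} {τ : RType O} (d : Derivable Γ t τ) :
    t.order ≤ τ.order := by
  refine sSup_le_sSup ?_
  rintro _ ⟨n, rfl, u, hu⟩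
  exact ⟨n, rfl, hasArrows_of_lams n (d.reduces hu)⟩

end Derivable

/-! ## An abstract machine for head reduction -/

/-- The closures of the machine: a term with an environment, tagged by the time of its creation;
the `m`-th formal argument supplied to the initial term; or a free variable of the initial term. -/
inductive Closure : Type
  | clo : ℕ → Term → (ℕ → Closure) → Closure
  | virt : ℕ → Closure
  | free : ℕ → Closure

namespace Machine

/-- A stack: closures, and the number of formal arguments that have been consumed. -/
abbrev Stack : Type := List Closure × ℕ

/-- The states of the machine. -/
structure State : Type where
  code : Term
  env : ℕ → Closure
  stack : Stack

/-- The environment `e` under one more binder. -/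
def consEnv (c : Closure) (e : ℕ → Closure) : ℕ → Closure
  | 0 => c
  | x + 1 => e x

open Classical in
/-- Popping a stack on which `n` formal arguments are available below the closures. -/
noncomputable def pop (n : ℕ∞) : Stack → Option (Closure × Stack)
  | (c :: L, v) => some (c, L, v)
  | ([], v) => if (v : ℕ∞) < n then some (Closure.virt v, [], v + 1) else none

/-- The transition at time `k`. -/
noncomputable def step (n : ℕ∞) (k : ℕ) : State → Option State
  | ⟨Term.app t u, e, S⟩ => some ⟨t, e, Closure.clo k u e :: S.1, S.2⟩
  | ⟨Term.lam t, e, S⟩ => (pop n S).map fun p => ⟨t, consEnv p.1 e, p.2⟩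
  | ⟨Term.var x, e, S⟩ => match e x with
    | Closure.clo _ u e' => some ⟨u, e', S⟩
    | _ => none

variable (n : ℕ∞) (t₀ : Term)

/-- The run of the machine on `t₀`, with `n` formal arguments. -/
noncomputable def run : ℕ → Option State
  | 0 => some ⟨t₀, Closure.free, [], 0⟩
  | k + 1 => (run k).bind (step n k)

/-- The stack at time `k`. -/
noncomputable def stackAt (k : ℕ) : Stack := ((run n t₀ k).map State.stack).getD ([], 0)

/-- The times at which the closure `c` is called. -/
def calls (c : Closure) : Set ℕ :=
  {k | ∃ x e S, run n t₀ k = some ⟨Term.var x, e, S⟩ ∧ e x = c}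

/-- The times at which the variable `x` is called by the evaluations of `u` that are triggered
by the one that starts at time `k`. -/
def uses : Term → ℕ → ℕ → Set ℕ
  | Term.var y, k, x => {j | j = k ∧ x = y}
  | Term.lam t, k, x => uses t (k + 1) (x + 1)
  | Term.app t u, k, x =>
      {j | j ∈ uses t (k + 1) x ∨
        ∃ i, (∃ e, i ∈ calls n t₀ (Closure.clo k u e)) ∧ j ∈ uses u (i + 1) x}

/-- The machine never meets an abstraction with an exhausted stack. -/
def Total : Prop :=
  ∀ k t e S, run n t₀ k = some ⟨Term.lam t, e, S⟩ → ∃ p, pop n S = some p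

/-- The closure is formed by a transition of the run before time `k`. -/
def Valid (k : ℕ) (c : Closure) : Prop :=
  ∀ i u e, c = Closure.clo i u e → i < k ∧ ∃ t S, run n t₀ i = some ⟨Term.app t u, e, S⟩

/-! ### Transitions of the run and provenance of closures. -/

variable {n t₀}

theorem pop_eq_some {S : Stack} {c : Closure} {S' : Stack} (h : pop n S = some (c, S')) :
    S = (c :: S'.1, S'.2) ∨
      ((S.2 : ℕ∞) < n ∧ S.1 = [] ∧ c = Closure.virt S.2 ∧ S' = ([], S.2 + 1)) := by
  obtain ⟨_ | ⟨d, L⟩, v⟩ := S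
  · simp only [pop] at h
    split_ifs at h with hv
    simp only [Option.some.injEq, Prod.mk.injEq] at h
    exact Or.inr ⟨hv, rfl, h.1.symm, h.2.symm⟩
  · simp only [pop, Option.some.injEq, Prod.mk.injEq] at h
    obtain ⟨rfl, rfl⟩ := h
    exact Or.inl rfl

theorem run_app {k : ℕ} {t u : Term} {e : ℕ → Closure} {S : Stack}
    (h : run n t₀ k = some ⟨Term.app t u, e, S⟩) :
    run n t₀ (k + 1) = some ⟨t, e, Closure.clo k u e :: S.1, S.2⟩ := by
  simp [run, h, step]

theorem run_lam {k : ℕ} {t : Term} {e : ℕ → Closure} {S S' : Stack} {c : Closure}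
    (h : run n t₀ k = some ⟨Term.lam t, e, S⟩) (hp : pop n S = some (c, S')) :
    run n t₀ (k + 1) = some ⟨t, consEnv c e, S'⟩ := by
  simp [run, h, step, hp]

theorem run_var {k x i : ℕ} {u : Term} {e e' : ℕ → Closure} {S : Stack}
    (h : run n t₀ k = some ⟨Term.var x, e, S⟩) (hx : e x = Closure.clo i u e') :
    run n t₀ (k + 1) = some ⟨u, e', S⟩ := by
  simp [run, h, step, hx]

theorem run_succ {k : ℕ} {st : State} (h : run n t₀ (k + 1) = some st) :
    (∃ t u e S, run n t₀ k = some ⟨Term.app t u, e, S⟩ ∧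
      st = ⟨t, e, Closure.clo k u e :: S.1, S.2⟩) ∨
    (∃ t e S c S', run n t₀ k = some ⟨Term.lam t, e, S⟩ ∧ pop n S = some (c, S') ∧
      st = ⟨t, consEnv c e, S'⟩) ∨
    (∃ x e S i u e', run n t₀ k = some ⟨Term.var x, e, S⟩ ∧ e x = Closure.clo i u e' ∧
      st = ⟨u, e', S⟩) := by
  rw [run, Option.bind_eq_some_iff] at h
  obtain ⟨⟨x | t | ⟨t, u⟩, e, S⟩, hk, hs⟩ := h
  · refine Or.inr (Or.inr ?_)
    simp only [step] at hs
    split at hs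
    · rename_i i u e' hx
      exact ⟨x, e, S, i, u, e', hk, hx, (Option.some.inj hs).symm⟩
    · cases hs
  · refine Or.inr (Or.inl ?_)
    simp only [step, Option.map_eq_some_iff] at hs
    obtain ⟨⟨c, S'⟩, hp, rfl⟩ := hs
    exact ⟨t, e, S, c, S', hk, hp, rfl⟩
  · exact Or.inl ⟨t, u, e, S, hk, (Option.some.inj hs).symm⟩

theorem Valid.mono {k l : ℕ} {c : Closure} (h : Valid n t₀ k c) (hkl : k ≤ l) :
    Valid n t₀ l c := fun i u e hc => ⟨(h i u e hc).1.trans_le hkl, (h i u e hc).2⟩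

theorem valid_run (k : ℕ) : ∀ st, run n t₀ k = some st →
    (∀ x, Valid n t₀ k (st.env x)) ∧
      ∀ c ∈ st.stack.1, Valid n t₀ k c ∧ ∃ i u e, c = Closure.clo i u e := by
  induction k using Nat.strong_induction_on with
  | _ k ih =>
    intro st hst
    cases k with
    | zero =>
      cases hst
      exact ⟨fun x i u e h => (by cases h), fun c hc => absurd hc List.not_mem_nil⟩
    | succ k =>
      have hk := Nat.le_succ k
      rcases run_succ hst with ⟨t, u, e, S, hr, rfl⟩ | ⟨t, e, S, c, S', hr, hp, rfl⟩ |
        ⟨x, e, S, i, u, e', hr, hx, rfl⟩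
      · obtain ⟨h₁, h₂⟩ := ih k k.lt_succ_self _ hr
        refine ⟨fun x => (h₁ x).mono hk, fun c hc => ?_⟩
        rcases List.mem_cons.1 hc with rfl | hc
        · refine ⟨?_, _, _, _, rfl⟩
          rintro _ _ _ ⟨⟩
          exact ⟨k.lt_succ_self, _, _, hr⟩
        · exact ⟨(h₂ c hc).1.mono hk, (h₂ c hc).2⟩
      · obtain ⟨h₁, h₂⟩ := ih k k.lt_succ_self _ hr
        rcases pop_eq_some hp with rfl | ⟨-, -, rfl, rfl⟩
        · refine ⟨fun x => ?_, fun d hd => ?_⟩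
          · cases x with
            | zero => exact (h₂ c List.mem_cons_self).1.mono hk
            | succ x => exact (h₁ x).mono hk
          · have := h₂ d (List.mem_cons_of_mem _ hd)
            exact ⟨this.1.mono hk, this.2⟩
        · refine ⟨fun x => ?_, fun d hd => by cases hd⟩
          cases x with
          | zero => rintro _ _ _ ⟨⟩
          | succ x => exact (h₁ x).mono hk
      · obtain ⟨h₁, h₂⟩ := ih k k.lt_succ_self _ hr
        -- A call restores the environment of the earlier time at which the closure was formed,
        -- hence the strong induction.
        obtain ⟨hi, t, S', hr'⟩ := h₁ x i u e' hx
        refine ⟨fun y => ((ih i (hi.trans k.lt_succ_self) _ hr').1 y).mono ?_,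
          fun c hc => ⟨(h₂ c hc).1.mono hk, (h₂ c hc).2⟩⟩
        exact (hi.trans k.lt_succ_self).le

theorem calls_clo {i k : ℕ} {u : Term} {e : ℕ → Closure}
    (h : k ∈ calls n t₀ (Closure.clo i u e)) :
    i < k ∧ (∃ t S, run n t₀ i = some ⟨Term.app t u, e, S⟩) ∧
      run n t₀ (k + 1) = some ⟨u, e, stackAt n t₀ k⟩ := by
  obtain ⟨x, e', S, hr, hx⟩ := h
  obtain ⟨hi, h'⟩ := (valid_run k _ hr).1 x i u e hx
  refine ⟨hi, h', ?_⟩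
  rw [run_var hr hx]
  simp [stackAt, hr]

/-- The time tag determines a called closure, as the run has one state at each time. This handles
the environment that `uses` quantifies existentially. -/
theorem calls_clo_of_run {k i : ℕ} {t u u' : Term} {e e' : ℕ → Closure} {S : Stack}
    (hr : run n t₀ k = some ⟨Term.app t u, e, S⟩) (h : i ∈ calls n t₀ (Closure.clo k u' e')) :
    run n t₀ (i + 1) = some ⟨u, e, stackAt n t₀ i⟩ ∧ i ∈ calls n t₀ (Closure.clo k u e) := by
  obtain ⟨-, ⟨t', S', hr'⟩, h₂⟩ := calls_clo h
  rw [hr] at hr'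
  cases hr'
  exact ⟨h₂, h⟩

theorem uses_subset_calls (hT : Total n t₀) : ∀ (u : Term) (k : ℕ) (e : ℕ → Closure) (S : Stack)
    (x : ℕ), run n t₀ k = some ⟨u, e, S⟩ → uses n t₀ u k x ⊆ calls n t₀ (e x)
  | Term.var y, k, e, S, x, h, j, hj => by
    obtain ⟨rfl, rfl⟩ := hj
    exact ⟨x, e, S, h, rfl⟩
  | Term.lam t, k, e, S, x, h, j, hj => by
    obtain ⟨⟨c, S'⟩, hp⟩ := hT k t e S h
    exact uses_subset_calls hT t (k + 1) _ _ (x + 1) (run_lam h hp) hj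
  | Term.app t u, k, e, S, x, h, j, hj => by
    rcases hj with hj | ⟨i, ⟨e', hi⟩, hj⟩
    · exact uses_subset_calls hT t (k + 1) _ _ x (run_app h) hj
    · exact uses_subset_calls hT u (i + 1) _ _ x (calls_clo_of_run h hi).1 hj

/-! ### A closure is popped at most once -/

/-- The closure `c` may still be popped from the stack. -/
def InStack (c : Closure) (S : Stack) : Prop := c ∈ S.1 ∨ ∃ m, S.2 ≤ m ∧ c = Closure.virt m

theorem inStack_pop {S S' : Stack} {c : Closure} (h : pop n S = some (c, S')) : InStack c S := by
  rcases pop_eq_some h with rfl | ⟨-, -, rfl, -⟩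
  · exact Or.inl List.mem_cons_self
  · exact Or.inr ⟨_, le_rfl, rfl⟩

theorem inStack_of_pop {S S' : Stack} {c d : Closure} (h : pop n S = some (c, S'))
    (hd : InStack d S') : InStack d S := by
  rcases pop_eq_some h with rfl | ⟨-, -, rfl, rfl⟩
  · rcases hd with hd | hd
    · exact Or.inl (List.mem_cons_of_mem _ hd)
    · exact Or.inr hd
  · rcases hd with hd | ⟨m, hm, rfl⟩
    · cases hd
    · exact Or.inr ⟨m, (Nat.le_succ _).trans hm, rfl⟩

theorem not_inStack_clo {k : ℕ} {st : State} (h : run n t₀ k = some st) {u : Term}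
    {e : ℕ → Closure} : ¬ InStack (Closure.clo k u e) st.stack := by
  rintro (hc | ⟨m, -, hc⟩)
  · exact lt_irrefl _ (((valid_run k _ h).2 _ hc).1 k u e rfl).1
  · cases hc

theorem nodup_run (k : ℕ) : ∀ st, run n t₀ k = some st → st.stack.1.Nodup := by
  induction k with
  | zero => rintro _ ⟨⟩; exact List.nodup_nil
  | succ k ih =>
    intro st hst
    rcases run_succ hst with ⟨t, u, e, S, hr, rfl⟩ | ⟨t, e, S, c, S', hr, hp, rfl⟩ |
      ⟨x, e, S, i, u, e', hr, hx, rfl⟩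
    · exact List.nodup_cons.2 ⟨fun hc => not_inStack_clo hr (Or.inl hc), ih _ hr⟩
    · rcases pop_eq_some hp with rfl | ⟨-, -, rfl, rfl⟩
      · exact (List.nodup_cons.1 (ih _ hr)).2
      · exact List.nodup_nil
    · exact (ih _ hr :)

/-- A closure enters the stack only when formed, with a fresh tag, and the counter of formal
arguments never decreases; so nothing popped can come back. -/
theorem not_inStack_of_popped {i : ℕ} {t : Term} {e : ℕ → Closure} {S S' : Stack} {c : Closure}
    (h : run n t₀ i = some ⟨Term.lam t, e, S⟩) (hp : pop n S = some (c, S')) (k : ℕ)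
    (hk : i + 1 ≤ k) : ∀ st, run n t₀ k = some st → ¬ InStack c st.stack := by
  induction k, hk using Nat.le_induction with
  | base =>
    rw [run_lam h hp]
    rintro _ ⟨⟩
    have hn := nodup_run i _ h
    rcases pop_eq_some hp with rfl | ⟨-, -, rfl, rfl⟩
    · rintro (hc | ⟨m, -, rfl⟩)
      · exact (List.nodup_cons.1 hn).1 hc
      · obtain ⟨-, _, _, _, hc⟩ := (valid_run i _ h).2 _ List.mem_cons_self
        cases hc
    · rintro (hc | ⟨m, hm, hc⟩)
      · cases hc
      · cases hc
        exact Nat.not_succ_le_self _ hm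
  | succ k hk ih =>
    intro st hst
    rcases run_succ hst with ⟨t', u, e', S₁, hr, rfl⟩ | ⟨t', e', S₁, d, S₂, hr, hp', rfl⟩ |
      ⟨x, e', S₁, j, u, e'', hr, hx, rfl⟩
    · rintro (hc | hc)
      · rcases List.mem_cons.1 hc with rfl | hc
        · rcases inStack_pop hp with hc | ⟨m, -, hc⟩
          -- A closure formed at time `k` cannot already lie in the stack at the earlier time `i`.
          · have := (((valid_run i _ h).2 _ hc).1 _ _ _ rfl).1
            omega
          · cases hc
        · exact ih _ hr (Or.inl hc)
      · exact ih _ hr (Or.inr hc)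
    · exact fun hc => ih _ hr (inStack_of_pop hp' hc)
    · exact (ih _ hr :)

theorem popped_unique {i j : ℕ} {t t' : Term} {e e' : ℕ → Closure} {S S' R R' : Stack}
    {c : Closure} (hi : run n t₀ i = some ⟨Term.lam t, e, S⟩) (hpi : pop n S = some (c, S'))
    (hj : run n t₀ j = some ⟨Term.lam t', e', R⟩) (hpj : pop n R = some (c, R')) : i = j := by
  rcases lt_trichotomy i j with h | h | h
  · exact absurd (inStack_pop hpj) (not_inStack_of_popped hi hpi j h _ hj)
  · exact h
  · exact absurd (inStack_pop hpi) (not_inStack_of_popped hj hpj i h _ hi)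

/-- A binding to `c` is traced back in time: it is inherited from the preceding state or, after a
call, from the state that formed the called closure, and the uses only grow on the way. The trace
must end at the unique pop of `c`. -/
theorem uses_subset_of_popped {i : ℕ} {t : Term} {e : ℕ → Closure} {S S' : Stack} {c : Closure}
    (h : run n t₀ i = some ⟨Term.lam t, e, S⟩) (hp : pop n S = some (c, S')) (k : ℕ) :
    ∀ st x, run n t₀ k = some st → st.env x = c →
      uses n t₀ st.code k x ⊆ uses n t₀ t (i + 1) 0 := by
  induction k using Nat.strong_induction_on with
  | _ k ih =>
    intro st x hst hx
    cases k with
    | zero =>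
      cases hst
      subst hx
      rcases inStack_pop hp with hc | ⟨m, -, hc⟩
      · obtain ⟨-, _, _, _, hc⟩ := (valid_run i _ h).2 _ hc
        cases hc
      · cases hc
    | succ k =>
      rcases run_succ hst with ⟨t', u, e', S₁, hr, rfl⟩ | ⟨t', e', S₁, d, S₂, hr, hp', rfl⟩ |
        ⟨y, e', S₁, j, u, e'', hr, hy, rfl⟩
      · exact fun l hl => ih k k.lt_succ_self _ x hr hx (Or.inl hl)
      · cases x with
        | zero =>
          have hd : d = c := hx
          subst hd
          obtain rfl := popped_unique h hp hr hp'
          rw [h] at hr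
          cases hr
          exact subset_rfl
        | succ x => exact ih k k.lt_succ_self _ x hr hx
      · obtain ⟨hj, ⟨t', S₂, hr'⟩, -⟩ := calls_clo ⟨y, e', S₁, hr, hy⟩
        exact fun l hl => ih j (hj.trans k.lt_succ_self) _ x hr' hx
          (Or.inr ⟨k, ⟨_, y, e', S₁, hr, hy⟩, hl⟩)

theorem uses_eq_calls (hT : Total n t₀) {i : ℕ} {t : Term} {e : ℕ → Closure} {S S' : Stack}
    {c : Closure} (h : run n t₀ i = some ⟨Term.lam t, e, S⟩) (hp : pop n S = some (c, S')) :
    uses n t₀ t (i + 1) 0 = calls n t₀ c := by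
  refine Set.Subset.antisymm (uses_subset_calls hT t (i + 1) _ _ 0 (run_lam h hp)) ?_
  rintro k ⟨x, e', R, hr, hx⟩
  -- At time `k` the code is the variable itself, whose only use is `k`.
  exact uses_subset_of_popped h hp k _ x hr hx ⟨rfl, rfl⟩

/-! ### The tree of the times of a run -/

variable (n t₀) in
/-- The time `q` continues the evaluation started at time `p`, or starts the evaluation of a
call to the closure formed at time `p`. -/
inductive Child : ℕ → ℕ → Prop
  | next {k : ℕ} {st : State} : run n t₀ k = some st → (∀ x, st.code ≠ Term.var x) →
      Child k (k + 1)
  | call {i k : ℕ} {u : Term} {e : ℕ → Closure} : k ∈ calls n t₀ (Closure.clo i u e) →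
      Child i (k + 1)

theorem Child.lt {p q : ℕ} (h : Child n t₀ p q) : p < q := by
  cases h with
  | next => exact Nat.lt_succ_self _
  | call h => exact (calls_clo h).1.trans (Nat.lt_succ_self _)

/-- The state just before `q` decides: a variable refers to one closure, whose tag is the parent;
any other code makes that preceding time the parent. -/
theorem Child.unique {p p' q : ℕ} (h : Child n t₀ p q) (h' : Child n t₀ p' q) : p = p' := by
  cases h with
  | next hr hv =>
    cases h' with
    | next => rfl
    | call hc =>
      obtain ⟨x, e, S, hr', -⟩ := hc
      rw [hr] at hr'
      cases hr'
      exact absurd rfl (hv x)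
  | call hc =>
    obtain ⟨x, e, S, hr, hx⟩ := hc
    cases h' with
    | next hr' hv =>
      rw [hr] at hr'
      cases hr'
      exact absurd rfl (hv x)
    | call hc' =>
      obtain ⟨x', e', S', hr', hx'⟩ := hc'
      rw [hr] at hr'
      cases hr'
      rw [hx] at hx'
      cases hx'
      rfl

theorem le_of_descendant {p q : ℕ} (h : Relation.ReflTransGen (Child n t₀) p q) : p ≤ q := by
  induction h with
  | refl => exact le_rfl
  | tail _ h ih => exact ih.trans h.lt.le

theorem not_descendant_sibling {p a b : ℕ} (ha : Child n t₀ p a) (hb : Child n t₀ p b)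
    (h : Relation.ReflTransGen (Child n t₀) a b) : a = b := by
  rcases Relation.ReflTransGen.cases_tail h with h | ⟨c, hc, hcb⟩
  · exact h.symm
  · obtain rfl := hcb.unique hb
    exact absurd ha.lt (le_of_descendant hc).not_gt

/-- By uniqueness of parents the ancestors of `k` form a chain, and two comparable siblings coincide
because time increases along edges. -/
theorem sibling_eq {p a b k : ℕ} (ha : Child n t₀ p a) (hb : Child n t₀ p b)
    (hak : Relation.ReflTransGen (Child n t₀) a k)
    (hbk : Relation.ReflTransGen (Child n t₀) b k) : a = b := by
  have hU : Relator.RightUnique (Function.swap (Child n t₀)) := fun _ _ _ h h' => h.unique h'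
  rcases Relation.ReflTransGen.total_of_right_unique hU
    (Relation.reflTransGen_swap.2 hak) (Relation.reflTransGen_swap.2 hbk) with h | h
  · exact (not_descendant_sibling hb ha (Relation.reflTransGen_swap.1 h)).symm
  · exact not_descendant_sibling ha hb (Relation.reflTransGen_swap.1 h)

theorem descendant_of_mem_uses (hT : Total n t₀) : ∀ (u : Term) (k : ℕ) (e : ℕ → Closure)
    (S : Stack) (x j : ℕ), run n t₀ k = some ⟨u, e, S⟩ → j ∈ uses n t₀ u k x →
      Relation.ReflTransGen (Child n t₀) k j
  | Term.var y, k, e, S, x, j, h, hj => by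
    obtain ⟨rfl, -⟩ := hj
    exact Relation.ReflTransGen.refl
  | Term.lam t, k, e, S, x, j, h, hj => by
    obtain ⟨⟨c, S'⟩, hp⟩ := hT k t e S h
    exact (descendant_of_mem_uses hT t (k + 1) _ _ (x + 1) j (run_lam h hp) hj).head
      (Child.next h fun x hx => by cases hx)
  | Term.app t u, k, e, S, x, j, h, hj => by
    rcases hj with hj | ⟨i, ⟨e', hi⟩, hj⟩
    · exact (descendant_of_mem_uses hT t (k + 1) _ _ x j (run_app h) hj).head
        (Child.next h fun x hx => by cases hx)
    · exact (descendant_of_mem_uses hT u (i + 1) _ _ x j (calls_clo_of_run h hi).1 hj).head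
        (Child.call hi)

/-! ### The types of the stacks -/

variable (n t₀) in
/-- The type of a stack: an argument has the types of the stacks with which it is called. -/
noncomputable def stackType (O : Type) [Nonempty O] : Stack → RType O :=
  QPF.Cofix.corec (F := RTypeF O) fun S => match pop n S with
    | none => RTypeF.atom (Classical.arbitrary O)
    | some p => RTypeF.arrow (CMultiset.ofFamily fun k : calls n t₀ p.1 => stackAt n t₀ k) p.2

variable {O : Type} [Nonempty O]

theorem stackType_none {S : Stack} (h : pop n S = none) :
    stackType n t₀ O S = RType.atom (Classical.arbitrary O) := by
  rw [← RType.mk_dest (stackType n t₀ O S), RType.atom]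
  congr 1
  refine (QPF.Cofix.dest_corec (F := RTypeF O) _ S).trans ?_
  rw [h]
  rfl

theorem stackType_some {S S' : Stack} {c : Closure} (h : pop n S = some (c, S')) :
    stackType n t₀ O S =
      RType.arrow (CMultiset.ofFamily fun k : calls n t₀ c => stackType n t₀ O (stackAt n t₀ k))
        (stackType n t₀ O S') := by
  rw [← RType.mk_dest (stackType n t₀ O S), RType.arrow]
  congr 1
  refine (QPF.Cofix.dest_corec (F := RTypeF O) _ S).trans ?_
  rw [h]
  rfl

/-- Once no closure is left, each arrow consumes one formal argument; the last of `m + 1` arrows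
consumes number `v + m`. -/
theorem hasArrows_stackType (m : ℕ) :
    ∀ v : ℕ, RType.HasArrows (m + 1) (stackType n t₀ O ([], v)) ↔ (v + m : ℕ) < n := by
  induction m with
  | zero =>
    intro v
    by_cases hv : (v : ℕ∞) < n
    · simp only [hv, Nat.add_zero, iff_true]
      exact ⟨_, _, stackType_some (by simp only [pop, if_pos hv]; rfl), trivial⟩
    · simp only [hv, Nat.add_zero, iff_false]
      rintro ⟨M, τ, h, -⟩
      rw [stackType_none (by simp only [pop, if_neg hv])] at h
      exact RType.atom_ne_arrow _ _ _ h
  | succ m ih =>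
    intro v
    by_cases hv : (v : ℕ∞) < n
    · have e := stackType_some (O := O) (t₀ := t₀) (n := n) (S := ([], v)) (c := Closure.virt v)
        (S' := ([], v + 1)) (by simp only [pop, if_pos hv])
      rw [show v + (m + 1) = v + 1 + m by omega, ← ih (v + 1)]
      constructor
      · rintro ⟨M, τ, h, hτ⟩
        rw [e] at h
        rw [(RType.arrow_inj h).2]
        exact hτ
      · exact fun h => ⟨_, _, e, h⟩
    · constructor
      · rintro ⟨M, τ, h, -⟩
        rw [stackType_none (by simp only [pop, if_neg hv])] at h
        exact absurd h (RType.atom_ne_arrow _ _ _)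
      · intro h
        refine absurd (lt_of_le_of_lt ?_ h) hv
        exact_mod_cast Nat.le_add_right v (m + 1)

theorem order_stackType : (stackType n t₀ O ([], 0)).order = n := by
  refine le_antisymm (sSup_le ?_) (ENat.forall_natCast_le_iff_le.1 fun m hm => ?_)
  · rintro _ ⟨m, rfl, hm⟩
    cases m with
    | zero => simp
    | succ m =>
      have := (hasArrows_stackType m 0).1 hm
      rw [Nat.zero_add] at this
      exact_mod_cast Order.add_one_le_of_lt this
  · refine le_sSup ⟨m, rfl, ?_⟩
    cases m with
    | zero => trivial
    | succ m =>
      refine (hasArrows_stackType m 0).2 (lt_of_lt_of_le ?_ hm)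
      rw [Nat.zero_add]
      exact_mod_cast m.lt_succ_self

/-! ### The typing derivation of a run -/

/-- The union defining `uses` at an application is disjoint: the evaluation of the function and
those of the argument start at distinct children of `k`, whose descendants are disjoint.
Multiplicities therefore agree. -/
theorem ofFamily_uses_app (hT : Total n t₀) {k : ℕ} {t u : Term} {e : ℕ → Closure} {S : Stack}
    (h : run n t₀ k = some ⟨Term.app t u, e, S⟩) {X : Type} (f : ℕ → X) (x : ℕ) :
    CMultiset.ofFamily (fun j : uses n t₀ t (k + 1) x => f j) +
      CMultiset.sum (fun i : calls n t₀ (Closure.clo k u e) =>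
        CMultiset.ofFamily fun j : uses n t₀ u (i + 1) x => f j) =
    CMultiset.ofFamily (fun j : uses n t₀ (Term.app t u) k x => f j) := by
  rw [CMultiset.sum_ofFamily, CMultiset.add_ofFamily]
  let F : (uses n t₀ t (k + 1) x) ⊕
      (Σ i : calls n t₀ (Closure.clo k u e), uses n t₀ u (i + 1) x) →
      uses n t₀ (Term.app t u) k x := fun q => match q with
    | Sum.inl j => ⟨j, Or.inl j.2⟩
    | Sum.inr p => ⟨p.2, Or.inr ⟨p.1, ⟨e, p.1.2⟩, p.2.2⟩⟩
  have c₀ : Child n t₀ k (k + 1) := Child.next h fun x hx => by cases hx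
  have d₀ : ∀ j ∈ uses n t₀ t (k + 1) x, Relation.ReflTransGen (Child n t₀) (k + 1) j :=
    fun j hj => descendant_of_mem_uses hT t (k + 1) _ _ x j (run_app h) hj
  have d₁ : ∀ i ∈ calls n t₀ (Closure.clo k u e), ∀ j ∈ uses n t₀ u (i + 1) x,
      Relation.ReflTransGen (Child n t₀) (i + 1) j :=
    fun i hi j hj => descendant_of_mem_uses hT u (i + 1) _ _ x j (calls_clo_of_run h hi).1 hj
  have ne : ∀ i ∈ calls n t₀ (Closure.clo k u e), ∀ j ∈ uses n t₀ t (k + 1) x,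
      j ∉ uses n t₀ u (i + 1) x := by
    intro i hi j hj hj'
    -- A common use would force `k + 1 = i + 1`, but a closure is called after it is formed.
    have := sibling_eq c₀ (Child.call hi) (d₀ j hj) (d₁ i hi j hj')
    have := (calls_clo hi).1
    omega
  refine (CMultiset.ofFamily_eq_iff _ _).2 ⟨Equiv.ofBijective F ⟨?_, ?_⟩, ?_⟩
  · rintro (⟨j, hj⟩ | ⟨⟨i, hi⟩, j, hj⟩) (⟨j', hj'⟩ | ⟨⟨i', hi'⟩, j', hj'⟩) hF
    · obtain rfl : j = j' := congrArg Subtype.val hF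
      rfl
    · obtain rfl : j = j' := congrArg Subtype.val hF
      exact absurd hj' (ne i' hi' j hj)
    · obtain rfl : j = j' := congrArg Subtype.val hF
      exact absurd hj (ne i hi j hj')
    · obtain rfl : j = j' := congrArg Subtype.val hF
      obtain rfl : i = i' := Nat.succ_injective
        (sibling_eq (Child.call hi) (Child.call hi') (d₁ i hi j hj) (d₁ i' hi' j hj'))
      rfl
  · rintro ⟨j, hj | ⟨i, ⟨e', hi⟩, hj⟩⟩
    · exact ⟨Sum.inl ⟨j, hj⟩, rfl⟩
    · exact ⟨Sum.inr ⟨⟨i, (calls_clo_of_run h hi).2⟩, j, hj⟩, rfl⟩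
  · rintro (j | p) <;> rfl

theorem ofFamily_congr_set {A B : Set ℕ} (h : A = B) {X : Type} (f : ℕ → X) :
    CMultiset.ofFamily (fun j : A => f j) = CMultiset.ofFamily (fun j : B => f j) := by
  subst h
  rfl

/-- The recursion is on the code. An abstraction matches the stack type because its source is
indexed by the calls of the popped closure; an application types its argument once for each call,
with the stack met at that call. -/
theorem derivable_run (hT : Total n t₀) : ∀ (u : Term) (k : ℕ) (e : ℕ → Closure) (S : Stack),
    run n t₀ k = some ⟨u, e, S⟩ →
      Derivable (fun x => CMultiset.ofFamily fun j : uses n t₀ u k x =>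
        stackType n t₀ O (stackAt n t₀ j)) u (stackType n t₀ O S)
  | Term.var y, k, e, S, h => by
    refine (Derivable.ax y _).of_eq ?_
    funext x
    have hS : stackAt n t₀ k = S := by simp [stackAt, h]
    unfold RContext.single
    split_ifs with hx
    · refine (CMultiset.ofFamily_eq_iff _ _).2 ⟨⟨fun _ => ⟨k, rfl, hx⟩, fun _ => (),
        fun _ => rfl, ?_⟩, fun _ => by rw [← hS]; rfl⟩
      rintro ⟨j, rfl, -⟩
      rfl
    · have : IsEmpty (uses n t₀ (Term.var y) k x) := ⟨fun j => hx j.2.2⟩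
      exact (CMultiset.ofFamily_eq_iff _ _).2 ⟨Equiv.equivOfIsEmpty _ _, fun i => i.elim⟩
  | Term.lam t, k, e, S, h => by
    obtain ⟨⟨c, S'⟩, hp⟩ := hT k t e S h
    have d := (derivable_run hT t (k + 1) _ _ (run_lam h hp)).abs
    rw [ofFamily_congr_set (uses_eq_calls hT h hp)
      fun j => stackType n t₀ O (stackAt n t₀ j), ← stackType_some hp] at d
    exact d
  | Term.app t u, k, e, S, h => by
    have d := derivable_run hT t (k + 1) _ _ (run_app h)
    rw [stackType_some (c := Closure.clo k u e) (S' := S) rfl] at d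
    refine (d.app fun i => derivable_run hT u (i + 1) _ _ (calls_clo_of_run h i.2).1).of_eq ?_
    funext x
    exact ofFamily_uses_app hT h (fun j => stackType n t₀ O (stackAt n t₀ j)) x

end Machine

/-! ## Substitution calculus -/

namespace Term

theorem rename_rename (t : Term) : ∀ r r' : ℕ → ℕ,
    (t.rename r).rename r' = t.rename (fun x => r' (r x)) := by
  induction t with
  | var x => exact fun _ _ => rfl
  | lam t ih =>
    intro r r'
    refine congrArg lam ((ih _ _).trans (congrArg (fun q => t.rename q) ?_))
    funext x
    cases x <;> rfl
  | app t u iht ihu => exact fun r r' => congrArg₂ app (iht r r') (ihu r r')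

theorem subst_rename (t : Term) : ∀ (r : ℕ → ℕ) (s : ℕ → Term),
    (t.rename r).subst s = t.subst (fun x => s (r x)) := by
  induction t with
  | var x => exact fun _ _ => rfl
  | lam t ih =>
    intro r s
    refine congrArg lam ((ih _ _).trans (congrArg (fun q => t.subst q) ?_))
    funext x
    cases x <;> rfl
  | app t u iht ihu => exact fun r s => congrArg₂ app (iht r s) (ihu r s)

theorem rename_subst (t : Term) : ∀ (s : ℕ → Term) (r : ℕ → ℕ),
    (t.subst s).rename r = t.subst (fun x => (s x).rename r) := by
  induction t with
  | var x => exact fun _ _ => rfl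
  | lam t ih =>
    intro s r
    refine congrArg lam ((ih _ _).trans (congrArg (fun q => t.subst q) ?_))
    funext x
    cases x with
    | zero => rfl
    | succ x => exact (rename_rename (s x) _ _).trans (rename_rename (s x) r Nat.succ).symm
  | app t u iht ihu => exact fun s r => congrArg₂ app (iht s r) (ihu s r)

theorem subst_subst (t : Term) : ∀ s s' : ℕ → Term,
    (t.subst s).subst s' = t.subst (fun x => (s x).subst s') := by
  induction t with
  | var x => exact fun _ _ => rfl
  | lam t ih =>
    intro s s'
    refine congrArg lam ((ih _ _).trans (congrArg (fun q => t.subst q) ?_))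
    funext x
    cases x with
    | zero => rfl
    | succ x => exact (subst_rename (s x) _ _).trans (rename_subst (s x) s' Nat.succ).symm
  | app t u iht ihu => exact fun s s' => congrArg₂ app (iht s s') (ihu s s')

theorem subst_var (t : Term) : t.subst var = t := by
  induction t with
  | var x => rfl
  | lam t ih =>
    refine congrArg lam ((congrArg (fun q => t.subst q) ?_).trans ih)
    funext x
    cases x <;> rfl
  | app t u iht ihu => exact congrArg₂ app iht ihu

/-- `apps t [u₁, …, uₙ]` is `t u₁ … uₙ`. -/
def apps (t : Term) (L : List Term) : Term := L.foldl app t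

theorem Step.apps {t t' : Term} (h : Step t t') (L : List Term) : Step (t.apps L) (t'.apps L) := by
  induction L generalizing t t' with
  | nil => exact h
  | cons u L ih => exact ih (h.appLeft u)

theorem Step.lams {t t' : Term} (h : Step t t') : ∀ n, Step (Term.lams n t) (Term.lams n t')
  | 0 => h
  | n + 1 => (Step.lams h n).lam

theorem lams_lam (t : Term) : ∀ n, lams n (lam t) = lams (n + 1) t
  | 0 => rfl
  | n + 1 => congrArg lam (lams_lam t n)

theorem le_order {t u : Term} {n : ℕ} (h : Reduces t (lams n u)) : (n : ℕ∞) ≤ t.order :=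
  le_sSup ⟨n, rfl, u, h⟩

end Term

/-! ## The machine computes the head reduction -/

namespace Closure

/-- The term represented by a closure, under `v` binders for the formal arguments. -/
def readback (v : ℕ) : Closure → Term
  | clo _ u e => u.subst fun x => readback v (e x)
  | virt m => Term.var (v - 1 - m)
  | free x => Term.var (x + v)

/-- Only the first `v` formal arguments occur in the closure. -/
def Below (v : ℕ) : Closure → Prop
  | clo _ _ e => ∀ x, Below v (e x)
  | virt m => m < v
  | free _ => True

theorem Below.succ {v : ℕ} : ∀ {c : Closure}, Below v c → Below (v + 1) c
  | clo _ _ e, h => fun x => Below.succ (c := e x) (h x)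
  | virt _, h => Nat.lt_succ_of_lt h
  | free _, _ => trivial

/-- A new innermost binder shifts all indices. The bound on the formal arguments keeps the truncated
subtraction `v - 1 - m` exact. -/
theorem readback_succ {v : ℕ} : ∀ {c : Closure}, Below v c →
    readback (v + 1) c = (readback v c).rename Nat.succ
  | clo i u e, h => by
    refine Eq.trans ?_ (Term.rename_subst u _ _).symm
    exact congrArg (fun q => u.subst q) (funext fun x => readback_succ (c := e x) (h x))
  | virt m, h => congrArg Term.var (by
      have : m < v := h
      omega)
  | free x, _ => rfl

end Closure

namespace Machine

open Closure Term

variable {n : ℕ∞} {t₀ : Term}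

/-- The term represented by a state, under the binders of the consumed formal arguments. -/
def State.readback (st : State) : Term :=
  (st.code.subst fun x => (st.env x).readback st.stack.2).apps
    (st.stack.1.map (Closure.readback st.stack.2))

/-- Applications and calls leave the represented term unchanged. Popping a closure is a head
`β`-step, and popping a formal argument moves the abstraction into the prefix. -/
theorem reduces_readback (k : ℕ) : ∀ st, run n t₀ k = some st →
    Reduces t₀ (lams st.stack.2 st.readback) ∧ (∀ x, Below st.stack.2 (st.env x)) ∧
      ∀ c ∈ st.stack.1, Below st.stack.2 c := by
  induction k with
  | zero =>
    rintro _ ⟨⟩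
    refine ⟨?_, fun _ => trivial, fun c hc => absurd hc List.not_mem_nil⟩
    rw [show lams 0 (State.readback ⟨t₀, Closure.free, [], 0⟩) = t₀ from t₀.subst_var]
    exact Relation.ReflTransGen.refl
  | succ k ih =>
    intro st hst
    rcases run_succ hst with ⟨t, u, e, S, hr, rfl⟩ | ⟨t, e, S, c, S', hr, hp, rfl⟩ |
      ⟨x, e, S, i, u, e', hr, hx, rfl⟩
    · obtain ⟨h₁, h₂, h₃⟩ := ih _ hr
      refine ⟨h₁, h₂, fun c hc => ?_⟩
      rcases List.mem_cons.1 hc with rfl | hc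
      · exact h₂
      · exact h₃ c hc
    · obtain ⟨h₁, h₂, h₃⟩ := ih _ hr
      rcases pop_eq_some hp with rfl | ⟨-, hS, rfl, rfl⟩
      · refine ⟨h₁.tail ?_, fun x => ?_, fun d hd => h₃ d (List.mem_cons_of_mem _ hd)⟩
        · refine Step.lams ?_ _
          have hs := Step.beta (t.subst (liftSubst fun x => (e x).readback S'.2)) (c.readback S'.2)
          rw [subst_subst] at hs
          have he : (fun x => (liftSubst (fun x => (e x).readback S'.2) x).subst
              (instSubst (c.readback S'.2))) = fun x => (consEnv c e x).readback S'.2 := by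
            funext x
            cases x with
            | zero => rfl
            | succ x => exact (subst_rename _ _ _).trans (subst_var _)
          rw [he] at hs
          exact hs.apps _
        · cases x with
          | zero => exact h₃ c List.mem_cons_self
          | succ x => exact h₂ x
      · obtain ⟨L, v⟩ := S
        obtain rfl : L = [] := hS
        refine ⟨?_, fun x => ?_, fun d hd => absurd hd List.not_mem_nil⟩
        · have he : liftSubst (fun x => (e x).readback v) =
              fun x => (consEnv (Closure.virt v) e x).readback (v + 1) := by
            funext x
            cases x with
            | zero => exact congrArg Term.var (by omega)
            | succ x => exact (readback_succ (h₂ x)).symm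
          have h := h₁
          change Reduces t₀ (lams v (Term.lam (t.subst (liftSubst _)))) at h
          rw [lams_lam, he] at h
          exact h
        · cases x with
          | zero => exact v.lt_succ_self
          | succ x => exact (h₂ x).succ
    · obtain ⟨h₁, h₂, h₃⟩ := ih _ hr
      have hb := h₂ x
      refine ⟨?_, ?_, h₃⟩
      · have : State.readback ⟨Term.var x, e, S⟩ = State.readback ⟨u, e', S⟩ := by
          change apps ((e x).readback S.2) _ = _
          rw [hx]
          rfl
        change Reduces t₀ (lams S.2 (State.readback ⟨u, e', S⟩))
        rw [← this]
        exact h₁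
      · change Below S.2 (e x) at hb
        rw [hx] at hb
        exact hb

/-- An abstraction met after `v` formal arguments, with no closure left, exhibits a reduct with `v +
1` leading abstractions; hence `v` is below the order and one more argument is available. -/
theorem total_order (t₀ : Term) : Total t₀.order t₀ := by
  rintro k t e ⟨_ | ⟨c, L⟩, v⟩ h
  · have hr := (reduces_readback k _ h).1
    change Reduces t₀ (lams v (Term.lam _)) at hr
    rw [lams_lam] at hr
    have hv : (v : ℕ∞) < t₀.order :=
      lt_of_lt_of_le (by exact_mod_cast v.lt_succ_self) (le_order hr)
    exact ⟨_, if_pos hv⟩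
  · exact ⟨_, rfl⟩

end Machine

/-! ### Attainment of the order and discrimination. -/

theorem Term.exists_derivable_order_eq (O : Type) [Nonempty O] (t : Term) :
    ∃ (Γ : RContext O) (τ : RType O), Derivable Γ t τ ∧ τ.order = t.order :=
  ⟨_, _, Machine.derivable_run (Machine.total_order t) t 0 _ _ rfl, Machine.order_stackType⟩

theorem mainTheorem2 (O : Type) [Nonempty O] :
    (∀ (t : Term) (n : ℕ∞), t.order = n →
      (∃ (Γ : RContext O) (τ : RType O), Derivable Γ t τ ∧ τ.order = n) ∧
      (∀ (Γ : RContext O) (τ : RType O), Derivable Γ t τ → n ≤ τ.order)) ∧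
    (∀ t u : Term, t.order ≠ u.order → denotation O t ≠ denotation O u) := by
  -- A typing of `t` of least order is also a typing of `u`, so it bounds the order of `u`.
  have order_le : ∀ t u : Term, denotation O t = denotation O u → u.order ≤ t.order := by
    intro t u h
    obtain ⟨Γ, τ, d, hτ⟩ := t.exists_derivable_order_eq O
    have d' : (Γ, τ) ∈ denotation O u := h ▸ d
    exact hτ ▸ Derivable.order_le d'
  refine ⟨?_, fun t u hne h => hne (le_antisymm (order_le u t h.symm) (order_le t u h))⟩
  rintro t _ rfl
  exact ⟨t.exists_derivable_order_eq O, fun Γ τ d => d.order_le⟩
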